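/- Theorem (permutability). Let $\mathbb E$ be a regular category, that is, a finitely complete category in which regular epimorphisms are stable under pullback and every kernel pair has a coequalizer. A relation $R$ from $X$ to $Y$ is a subobject $\langle r_0,r_1\rangle\colon R\rightarrowtail X\times Y$ (a relation on $X$ if $Y=X$); its opposite $R^\circ$ is the subobject $\langle r_1,r_0\rangle\colon R\rightarrowtail Y\times X$; and the composite $S\circ R$ of $R$ with a relation $\langle s_0,s_1\rangle\colon S\rightarrowtail Y\times Z$ is the monomorphic part of the (regular epi)-mono factorization of $\langle r_0\pi_0,s_1\pi_1\rangle\colon R\times_Y S\to X\times Z$, where $\pi_0,\pi_1$ are the projections of the pullback of $r_1$ and $s_0$. A relation $U$ from $X$ to $Y$ is difunctional if $U\circ U^\circ\circ U\leqslant U$. A relation $R$ on $X$ is reflexive if $r_0$ and $r_1$ have a common section $X\to R$; symmetric if there is $s\colon R\to R$ with $r_0s=r_1$ and $r_1s=r_0$; transitive if there is $t\colon R\times_XR\to R$ with $r_0t=r_0\pi_0$ and $r_1t=r_1\pi_1$, where $R\times_XR$ is the pullback of $r_1$ and $r_0$, with projections $\pi_0,\pi_1$; and an equivalence relation if it is reflexive,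 symmetric and transitive. A finitely complete category is a Mal'tsev category if every reflexive relation in it is an equivalence relation. The following conditions are equivalent: 1. for any two equivalence relations $R$ and $S$ on any object $X$ of $\mathbb E$, $S\circ R=R\circ S$; 2. for any objects $X,Y$ of $\mathbb E$, every relation $U$ from $X$ to $Y$ is difunctional; 3. $\mathbb E$ is a Mal'tsev category; 4. every reflexive relation on any object of $\mathbb E$ is symmetric; 5. every reflexive relation on any object of $\mathbb E$ is transitive. -/

import Mathlib

open CategoryTheory CategoryTheory.Limits

universe v u

namespace InternalRelation

variable {C : Type u} [Category.{v} C]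

/-- A relation from `X` to `Y` is a subobject of the product `X ⨯ Y`. -/
abbrev Relation [HasFiniteLimits C] (X Y : C) := Subobject (X ⨯ Y)

/-- The first projection `r₀ : R ⟶ X` of a relation `⟨r₀, r₁⟩ : R ↣ X ⨯ Y`. -/
noncomputable def proj₀ [HasFiniteLimits C] {X Y : C} (R : Relation X Y) : (R : C) ⟶ X :=
  R.arrow ≫ prod.fst

/-- The second projection `r₁ : R ⟶ Y` of a relation `⟨r₀, r₁⟩ : R ↣ X ⨯ Y`. -/
noncomputable def proj₁ [HasFiniteLimits C] {X Y : C} (R : Relation X Y) : (R : C) ⟶ Y :=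
  R.arrow ≫ prod.snd

/-- The two projections of a relation are jointly monic. -/
theorem proj_ext [HasFiniteLimits C] {X Y : C} (R : Relation X Y) {Z : C} {a b : Z ⟶ (R : C)}
    (h₀ : a ≫ proj₀ R = b ≫ proj₀ R) (h₁ : a ≫ proj₁ R = b ≫ proj₁ R) : a = b := by
  rw [← cancel_mono R.arrow]
  ext
  · simpa [proj₀] using h₀
  · simpa [proj₁] using h₁

instance mono_lift_proj₁_proj₀ [HasFiniteLimits C] {X Y : C} (R : Relation X Y) :
    Mono (prod.lift (proj₁ R) (proj₀ R)) where
  right_cancellation a b h := proj_ext R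
    (by simpa [prod.lift_snd] using congrArg (fun k => k ≫ prod.snd) h)
    (by simpa [prod.lift_fst] using congrArg (fun k => k ≫ prod.fst) h)

/-- The opposite relation `R°` from `Y` to `X`: the subobject `⟨r₁, r₀⟩ : R ↣ Y ⨯ X`. -/
noncomputable def opposite [HasFiniteLimits C] {X Y : C} (R : Relation X Y) : Relation Y X :=
  Subobject.mk (prod.lift (proj₁ R) (proj₀ R))

/-- The composite `S ∘ R` (first `R`, then `S`): the monomorphic part of the
(regular epi, mono)-factorization of `⟨r₀ π₀, s₁ π₁⟩ : R ×_Y S ⟶ X ⨯ Z`, where `π₀` and `π₁` are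
the projections of the pullback of `r₁` and `s₀`. -/
noncomputable def comp [Regular C] {X Y Z : C} (S : Relation Y Z) (R : Relation X Y) :
    Relation X Z :=
  Subobject.mk (Regular.strongEpiMonoFactorisation
    (prod.lift (pullback.fst (proj₁ R) (proj₀ S) ≫ proj₀ R)
      (pullback.snd (proj₁ R) (proj₀ S) ≫ proj₁ S))).m

/-- `R` is reflexive: there is a common section `X ⟶ R` of `r₀` and `r₁`. -/
def IsReflexive [HasFiniteLimits C] {X : C} (R : Relation X X) : Prop :=
  Nonempty (ReflexiveRelation (proj₀ R) (proj₁ R))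

/-- `R` is symmetric: there is `s : R ⟶ R` interchanging `r₀` and `r₁`. -/
def IsSymmetric [HasFiniteLimits C] {X : C} (R : Relation X X) : Prop :=
  Nonempty (SymmetricRelation (proj₀ R) (proj₁ R))

/-- `R` is transitive: there is `t : R ×_X R ⟶ R` with `r₀ t = r₀ π₀` and `r₁ t = r₁ π₁`, where
`R ×_X R` is the pullback of `r₁` and `r₀`. -/
def IsTransitive [HasFiniteLimits C] {X : C} (R : Relation X X) : Prop :=
  Nonempty (TransitiveRelation (proj₀ R) (proj₁ R))

/-- `R` is an (internal) equivalence relation: reflexive, symmetric and transitive. -/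
def IsEquivalence [HasFiniteLimits C] {X : C} (R : Relation X X) : Prop :=
  IsEquivalenceRelation (proj₀ R) (proj₁ R)

/-- `U` is difunctional: `U ∘ U° ∘ U ≤ U`. -/
def IsDifunctional [Regular C] {X Y : C} (U : Relation X Y) : Prop :=
  comp U (comp (opposite U) U) ≤ U

/-- A finitely complete category is a Mal'tsev category when every reflexive relation in it is an
equivalence relation. -/
def IsMaltsev (C : Type u) [Category.{v} C] [HasFiniteLimits C] : Prop :=
  ∀ (X : C) (R : Relation X X), IsReflexive R → IsEquivalence R

end InternalRelation

/-! Relations are handled through generalized elements: `Rel R x y` behaves like a set-theoretic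
relation, and by `rel_comp` the intermediate element of a composite exists after passing to a
regular cover. Such covers can be discarded (`Rel.of_strongEpi`), so elementwise arguments apply.
Difunctionality is the hub. Permuting the kernel pairs of the two projections of `U` makes `U`
difunctional; difunctionality of a reflexive relation gives symmetry and transitivity; either of
these, applied to the reflexive `crossRelation U`, gives difunctionality back. Finally, if the
reflexive relation `S ∘ R` is symmetric, then `R` and `S` permute. -/

namespace InternalRelation

variable {C : Type u} [Category.{v} C]

/-! ### Calculus of generalized elements -/

section FiniteLimits

variable [HasFiniteLimits C] {X Y T T' : C}

/-- The generalized elements `x : T ⟶ X` and `y : T ⟶ Y` are related by `R`. -/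
def Rel (R : Relation X Y) (x : T ⟶ X) (y : T ⟶ Y) : Prop :=
  ∃ k : T ⟶ (R : C), k ≫ proj₀ R = x ∧ k ≫ proj₁ R = y

theorem rel_proj (R : Relation X Y) : Rel R (proj₀ R) (proj₁ R) :=
  ⟨𝟙 _, by simp, by simp⟩

theorem Rel.precomp {R : Relation X Y} {x : T ⟶ X} {y : T ⟶ Y} (h : Rel R x y) (e : T' ⟶ T) :
    Rel R (e ≫ x) (e ≫ y) := by
  obtain ⟨k, rfl, rfl⟩ := h
  exact ⟨e ≫ k, by simp, by simp⟩

theorem rel_iff_exists_arrow {R : Relation X Y} {x : T ⟶ X} {y : T ⟶ Y} :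
    Rel R x y ↔ ∃ k : T ⟶ (R : C), k ≫ R.arrow = prod.lift x y := by
  refine exists_congr fun k => ⟨fun h => ?_, fun h => ?_⟩
  · ext
    · simpa [proj₀, prod.lift_fst] using h.1
    · simpa [proj₁, prod.lift_snd] using h.2
  · simp [proj₀, proj₁, reassoc_of% h, prod.lift_fst, prod.lift_snd]

theorem rel_mk {A : C} (m : A ⟶ X ⨯ Y) [Mono m] {x : T ⟶ X} {y : T ⟶ Y} :
    Rel (Subobject.mk m) x y ↔ ∃ k : T ⟶ A, k ≫ m = prod.lift x y := by
  rw [rel_iff_exists_arrow]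
  constructor
  · rintro ⟨k, hk⟩
    exact ⟨k ≫ (Subobject.underlyingIso m).hom, by simpa using hk⟩
  · rintro ⟨k, hk⟩
    exact ⟨k ≫ (Subobject.underlyingIso m).inv, by simpa using hk⟩

/-- Being related descends along strong epimorphisms. -/
theorem Rel.of_strongEpi {R : Relation X Y} {x : T ⟶ X} {y : T ⟶ Y} (e : T' ⟶ T) [StrongEpi e]
    (h : Rel R (e ≫ x) (e ≫ y)) : Rel R x y := by
  obtain ⟨k, hk⟩ := rel_iff_exists_arrow.1 h
  have sq : CommSq k e R.arrow (prod.lift x y) := ⟨by rw [hk, prod.comp_lift]⟩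
  exact rel_iff_exists_arrow.2 ⟨sq.lift, sq.fac_right⟩

/-- Yoneda: the pair of projections is the universal pair related by `R`, so it suffices to test
that one. -/
theorem le_of_rel {R S : Relation X Y} (h : Rel S (proj₀ R) (proj₁ R)) : R ≤ S := by
  obtain ⟨k, h₀, h₁⟩ := h
  refine Subobject.le_of_comm k ?_
  ext
  · simpa [proj₀] using h₀
  · simpa [proj₁] using h₁

theorem Rel.mono {R S : Relation X Y} (h : R ≤ S) {x : T ⟶ X} {y : T ⟶ Y} (hR : Rel R x y) :
    Rel S x y := by
  obtain ⟨k, hk⟩ := rel_iff_exists_arrow.1 hR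
  exact rel_iff_exists_arrow.2 ⟨k ≫ Subobject.ofLE R S h, by simpa using hk⟩

theorem rel_opposite {R : Relation X Y} {x : T ⟶ X} {y : T ⟶ Y} :
    Rel (opposite R) y x ↔ Rel R x y := by
  rw [opposite, rel_mk]
  refine exists_congr fun k => ?_
  rw [prod.comp_lift]
  refine ⟨fun h => ⟨?_, ?_⟩, ?_⟩
  · simpa [prod.lift_snd] using congrArg (· ≫ prod.snd) h
  · simpa [prod.lift_fst] using congrArg (· ≫ prod.fst) h
  · rintro ⟨rfl, rfl⟩
    rfl

theorem jointlyMono₂_proj (R : Relation X Y) : JointlyMono₂ (proj₀ R) (proj₁ R) :=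
  ⟨fun _ _ _ => proj_ext R⟩

theorem isReflexive_iff {R : Relation X X} :
    IsReflexive R ↔ ∀ ⦃T : C⦄ (x : T ⟶ X), Rel R x x := by
  constructor
  · rintro ⟨h⟩ T x
    exact ⟨x ≫ h.r, by simp, by simp⟩
  · intro h
    obtain ⟨r, h₀, h₁⟩ := h (𝟙 X)
    exact ⟨{ jointlyMono₂_proj R with r := r, reflexivity₁ := h₀, reflexivity₂ := h₁ }⟩

theorem isSymmetric_iff {R : Relation X X} :
    IsSymmetric R ↔ ∀ ⦃T : C⦄ (x y : T ⟶ X), Rel R x y → Rel R y x := by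
  constructor
  · rintro ⟨h⟩ T _ _ ⟨k, rfl, rfl⟩
    exact ⟨k ≫ h.s, by simp, by simp⟩
  · intro h
    obtain ⟨s, h₀, h₁⟩ := h _ _ (rel_proj R)
    exact ⟨{ jointlyMono₂_proj R with s := s, symmetry₁ := h₀, symmetry₂ := h₁ }⟩

theorem isTransitive_iff {R : Relation X X} :
    IsTransitive R ↔ ∀ ⦃T : C⦄ (x y z : T ⟶ X), Rel R x y → Rel R y z → Rel R x z := by
  constructor
  · rintro ⟨h⟩ T _ _ _ ⟨k, rfl, rfl⟩ ⟨l, hl, rfl⟩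
    let m := PullbackCone.IsLimit.lift h.isLimit k l hl.symm
    have m₀ : m ≫ h.c.fst = k := PullbackCone.IsLimit.lift_fst ..
    have m₁ : m ≫ h.c.snd = l := PullbackCone.IsLimit.lift_snd ..
    exact ⟨m ≫ h.t, by simp [reassoc_of% m₀], by simp [reassoc_of% m₁]⟩
  · intro h
    obtain ⟨t, h₀, h₁⟩ := h _ _ _ ((rel_proj R).precomp (pullback.fst (proj₁ R) (proj₀ R)))
      (pullback.condition (f := proj₁ R) (g := proj₀ R) ▸
        (rel_proj R).precomp (pullback.snd (proj₁ R) (proj₀ R)))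
    exact ⟨{ jointlyMono₂_proj R with
      c := _
      isLimit := pullbackIsPullback (proj₁ R) (proj₀ R)
      t := t
      transitivity₁ := h₀
      transitivity₂ := h₁ }⟩

theorem isEquivalence_iff {R : Relation X X} :
    IsEquivalence R ↔ IsReflexive R ∧ IsSymmetric R ∧ IsTransitive R := by
  constructor
  · rintro ⟨⟨h⟩⟩
    exact ⟨⟨h.toReflexiveRelation⟩, ⟨h.toSymmetricRelation⟩, ⟨h.toTransitiveRelation⟩⟩
  · rintro ⟨⟨hr⟩, ⟨hs⟩, ⟨ht⟩⟩
    exact ⟨⟨{ hr, hs, ht with }⟩⟩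

/-- The inverse image of a relation `U` from `X` to `Y` along a pair of morphisms. -/
noncomputable def inverseImage {A B : C} (U : Relation X Y) (f : A ⟶ X) (g : B ⟶ Y) :
    Relation A B :=
  (Subobject.pullback (prod.map f g)).obj U

theorem rel_inverseImage {A B : C} {U : Relation X Y} {f : A ⟶ X} {g : B ⟶ Y}
    {a : T ⟶ A} {b : T ⟶ B} :
    Rel (inverseImage U f g) a b ↔ Rel U (a ≫ f) (b ≫ g) := by
  have sq := Subobject.isPullback (prod.map f g) U
  rw [inverseImage, rel_iff_exists_arrow, rel_iff_exists_arrow]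
  constructor
  · rintro ⟨k, hk⟩
    refine ⟨k ≫ Subobject.pullbackπ (prod.map f g) U, ?_⟩
    rw [Category.assoc, sq.w, ← Category.assoc]
    exact (congrArg (· ≫ prod.map f g) hk).trans (prod.lift_map ..)
  · rintro ⟨k, hk⟩
    exact ⟨sq.lift k (prod.lift a b) (by rw [hk, prod.lift_map]), sq.lift_snd ..⟩

/-- The diagonal relation on `X`. -/
noncomputable def diagonal (X : C) : Relation X X :=
  Subobject.mk (diag X)

theorem rel_diagonal {x y : T ⟶ X} : Rel (diagonal X) x y ↔ x = y := by
  rw [diagonal, rel_mk]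
  constructor
  · rintro ⟨k, hk⟩
    rw [prod.comp_diag] at hk
    have h₀ := congrArg (· ≫ prod.fst) hk
    have h₁ := congrArg (· ≫ prod.snd) hk
    simp only [prod.lift_fst, prod.lift_snd] at h₀ h₁
    exact h₀.symm.trans h₁
  · rintro rfl
    exact ⟨x, prod.comp_diag x⟩

/-- The kernel pair of `f`, as a relation. -/
noncomputable def kernelRelation (f : X ⟶ Y) : Relation X X :=
  inverseImage (diagonal Y) f f

theorem rel_kernelRelation {f : X ⟶ Y} {x y : T ⟶ X} :
    Rel (kernelRelation f) x y ↔ x ≫ f = y ≫ f := by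
  rw [kernelRelation, rel_inverseImage, rel_diagonal]

theorem isEquivalence_kernelRelation (f : X ⟶ Y) : IsEquivalence (kernelRelation f) := by
  simp only [isEquivalence_iff, isReflexive_iff, isSymmetric_iff, isTransitive_iff,
    rel_kernelRelation]
  exact ⟨fun _ _ => trivial, fun _ _ _ => Eq.symm, fun _ _ _ _ => Eq.trans⟩

end FiniteLimits

/-! ### Composition and the implications -/

section Regular

variable [Regular C] {X Y Z T : C}

/-- Generalized elements are related by a composite relation when, after passing to a regular
cover, there is an intermediate element. -/
theorem rel_comp {R : Relation X Y} {S : Relation Y Z} {x : T ⟶ X} {z : T ⟶ Z} :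
    Rel (comp S R) x z ↔ ∃ (T' : C) (e : T' ⟶ T) (y : T' ⟶ Y),
      IsRegularEpi e ∧ Rel R (e ≫ x) y ∧ Rel S y (e ≫ z) := by
  let f := prod.lift (pullback.fst (proj₁ R) (proj₀ S) ≫ proj₀ R)
    (pullback.snd (proj₁ R) (proj₀ S) ≫ proj₁ S)
  let F := Regular.strongEpiMonoFactorisation f
  constructor
  · intro h
    obtain ⟨k, hk⟩ := (rel_mk F.m).1 h
    have he : IsRegularEpi F.e := inferInstanceAs
      (IsRegularEpi (Regular.strongEpiMonoFactorisation f).e)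
    -- The cover is the pullback of `F.e` along `k`, a regular epimorphism by stability.
    let l := pullback.fst F.e k
    have hl : l ≫ f = pullback.snd F.e k ≫ prod.lift x z := by
      rw [← hk, ← Category.assoc, ← pullback.condition, Category.assoc, F.fac]
    simp only [f, prod.comp_lift] at hl
    have h₀ := congrArg (· ≫ prod.fst) hl
    have h₁ := congrArg (· ≫ prod.snd) hl
    simp only [prod.lift_fst, prod.lift_snd] at h₀ h₁
    refine ⟨_, pullback.snd F.e k, l ≫ pullback.fst _ _ ≫ proj₁ R, inferInstance,
      ⟨l ≫ pullback.fst _ _, by simpa using h₀, by simp⟩,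
      ⟨l ≫ pullback.snd _ _, by simp [pullback.condition], by simpa using h₁⟩⟩
  · rintro ⟨T', e, _, he, ⟨k, hk, rfl⟩, ⟨l, hl, hl'⟩⟩
    refine Rel.of_strongEpi e ((rel_mk F.m).2 ⟨pullback.lift k l hl.symm ≫ F.e, ?_⟩)
    rw [Category.assoc, F.fac, prod.comp_lift, pullback.lift_fst_assoc, pullback.lift_snd_assoc,
      hk, hl']

theorem Rel.comp {R : Relation X Y} {S : Relation Y Z} {x : T ⟶ X} {y : T ⟶ Y} {z : T ⟶ Z}
    (hR : Rel R x y) (hS : Rel S y z) : Rel (InternalRelation.comp S R) x z :=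
  rel_comp.2 ⟨T, 𝟙 T, y, inferInstance, by simpa using hR, by simpa using hS⟩

theorem isDifunctional_iff {U : Relation X Y} :
    IsDifunctional U ↔ ∀ ⦃T : C⦄ (a c : T ⟶ X) (b d : T ⟶ Y),
      Rel U a b → Rel U c b → Rel U c d → Rel U a d := by
  constructor
  · intro h T a c b d hab hcb hcd
    exact ((hab.comp (rel_opposite.2 hcb)).comp hcd).mono h
  · intro h
    refine le_of_rel ?_
    obtain ⟨T, e, c, he, h', hcd⟩ := rel_comp.1 (rel_proj (comp U (comp (opposite U) U)))
    obtain ⟨T', e', b, he', hab, hbc⟩ := rel_comp.1 h'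
    exact Rel.of_strongEpi e (Rel.of_strongEpi e'
      (h _ _ _ _ hab (rel_opposite.1 hbc) (hcd.precomp e')))

theorem isDifunctional_of_comp_comm
    (h : ∀ (X : C) (R S : Relation X X), IsEquivalence R → IsEquivalence S →
      comp S R = comp R S) (U : Relation X Y) : IsDifunctional U := by
  rw [isDifunctional_iff]
  rintro T _ _ _ _ ⟨k, rfl, rfl⟩ ⟨l, rfl, hl⟩ ⟨m, hm, rfl⟩
  -- As elements of `U`, `k = (a, b)` and `l = (c, b)` agree in the second coordinate, `l` and `m =
  -- (c, d)` in the first. Permuting yields, on a cover, `n = (a, d)` in `U`.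
  have hkm : Rel (comp (kernelRelation (proj₀ U)) (kernelRelation (proj₁ U))) k m :=
    (rel_kernelRelation.2 hl.symm).comp (rel_kernelRelation.2 hm.symm)
  rw [h U _ _ (isEquivalence_kernelRelation _) (isEquivalence_kernelRelation _)] at hkm
  obtain ⟨T', e, n, he, h₀, h₁⟩ := rel_comp.1 hkm
  rw [rel_kernelRelation, Category.assoc] at h₀ h₁
  exact Rel.of_strongEpi e ⟨n, h₀.symm, h₁⟩

theorem isMaltsev_of_isDifunctional (h : ∀ (X Y : C) (U : Relation X Y), IsDifunctional U) :
    IsMaltsev C := by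
  intro X R hR
  have hd := isDifunctional_iff.1 (h X X R)
  have hr := isReflexive_iff.1 hR
  -- Symmetry comes from `(y, y), (x, y), (x, x)`, transitivity from `(x, y), (y, y), (y, z)`.
  exact isEquivalence_iff.2 ⟨hR,
    isSymmetric_iff.2 fun _ x y hxy => hd _ _ _ _ (hr y) hxy (hr x),
    isTransitive_iff.2 fun _ x y z hxy hyz => hd _ _ _ _ hxy (hr y) hyz⟩

/-- The relation on `U` which relates `(a, b)` to `(c, d)` when `U` relates `a` to `d`. -/
noncomputable def crossRelation (U : Relation X Y) : Relation (U : C) (U : C) :=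
  inverseImage U (proj₀ U) (proj₁ U)

theorem isReflexive_crossRelation (U : Relation X Y) : IsReflexive (crossRelation U) :=
  isReflexive_iff.2 fun _ x => rel_inverseImage.2 ((rel_proj U).precomp x)

theorem isDifunctional_of_isSymmetric
    (h : ∀ (X : C) (R : Relation X X), IsReflexive R → IsSymmetric R) (U : Relation X Y) :
    IsDifunctional U := by
  rw [isDifunctional_iff]
  rintro T _ _ _ _ ⟨k, rfl, rfl⟩ hcb ⟨m, rfl, rfl⟩
  -- With `k = (a, b)` and `m = (c, d)`, the cross relation holds from `m` to `k` because `U`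
  -- relates `c` to `b`; reversed, it says that `U` relates `a` to `d`.
  exact rel_inverseImage.1 (isSymmetric_iff.1 (h _ _ (isReflexive_crossRelation U)) m k
    (rel_inverseImage.2 hcb))

theorem isDifunctional_of_isTransitive
    (h : ∀ (X : C) (R : Relation X X), IsReflexive R → IsTransitive R) (U : Relation X Y) :
    IsDifunctional U := by
  rw [isDifunctional_iff]
  rintro T _ _ _ _ ⟨k, rfl, rfl⟩ ⟨l, rfl, hl⟩ ⟨m, hm, rfl⟩
  -- The middle term is `l = (c, b)`: the two links are `(a, b)` and `(c, d)` in `U`.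
  refine rel_inverseImage.1 (isTransitive_iff.1 (h _ _ (isReflexive_crossRelation U)) k l m
    (rel_inverseImage.2 ⟨k, rfl, hl.symm⟩) (rel_inverseImage.2 ⟨m, hm, rfl⟩))

/-- The composite is reflexive, hence symmetric, while its opposite is `R° ∘ S° = R ∘ S`. -/
theorem comp_le_comp_of_isSymmetric
    (h : ∀ (X : C) (R : Relation X X), IsReflexive R → IsSymmetric R) {R S : Relation X X}
    (hR : IsEquivalence R) (hS : IsEquivalence S) : comp S R ≤ comp R S := by
  obtain ⟨hRr, hRs, -⟩ := isEquivalence_iff.1 hR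
  obtain ⟨hSr, hSs, -⟩ := isEquivalence_iff.1 hS
  rw [isReflexive_iff] at hRr hSr
  rw [isSymmetric_iff] at hRs hSs
  have hSR : IsReflexive (comp S R) := isReflexive_iff.2 fun _ x => (hRr x).comp (hSr x)
  refine le_of_rel ?_
  obtain ⟨T, e, y, he, hzy, hyx⟩ :=
    rel_comp.1 (isSymmetric_iff.1 (h _ _ hSR) _ _ (rel_proj (comp S R)))
  exact rel_comp.2 ⟨T, e, y, he, hSs _ _ hyx, hRs _ _ hzy⟩

end Regular

end InternalRelation

theorem mainTheorem4 (C : Type u) [Category.{v} C] [Regular C] :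
    List.TFAE [
      ∀ (X : C) (R S : InternalRelation.Relation X X),
        InternalRelation.IsEquivalence R → InternalRelation.IsEquivalence S →
          InternalRelation.comp S R = InternalRelation.comp R S,
      ∀ (X Y : C) (U : InternalRelation.Relation X Y), InternalRelation.IsDifunctional U,
      InternalRelation.IsMaltsev C,
      ∀ (X : C) (R : InternalRelation.Relation X X),
        InternalRelation.IsReflexive R → InternalRelation.IsSymmetric R,
      ∀ (X : C) (R : InternalRelation.Relation X X),
        InternalRelation.IsReflexive R → InternalRelation.IsTransitive R] := by
  tfae_have 1 → 2 := fun h _ _ U => InternalRelation.isDifunctional_of_comp_comm h U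
  tfae_have 2 → 3 := InternalRelation.isMaltsev_of_isDifunctional
  tfae_have 3 → 4 := fun h X R hR => (InternalRelation.isEquivalence_iff.1 (h X R hR)).2.1
  tfae_have 3 → 5 := fun h X R hR => (InternalRelation.isEquivalence_iff.1 (h X R hR)).2.2
  tfae_have 4 → 2 := fun h _ _ U => InternalRelation.isDifunctional_of_isSymmetric h U
  tfae_have 5 → 2 := fun h _ _ U => InternalRelation.isDifunctional_of_isTransitive h U
  tfae_have 4 → 1 := fun h _ _ _ hR hS =>
    le_antisymm (InternalRelation.comp_le_comp_of_isSymmetric h hR hS)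
      (InternalRelation.comp_le_comp_of_isSymmetric h hS hR)
  tfae_finish
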